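/- Let $\mathcal G$ be a connected weighted undirected graph on $\{1,\dots,N\}$ with weights $a_{ij}=a_{ji}\ge 0$, $a_{ii}=0$, where $i,j$ are adjacent iff $a_{ij}>0$; for $v\in\mathbb R^N$ write $v_i^v=\sum_{j=1}^N a_{ij}(v_i-v_j)$. Consider $N$ agents $\dot x_i=g_i(x_i,u_i)$, $y_i=h_i(x_i)$, with $x_i\in\mathbb R^{n_i}$, $u_i,y_i\in\mathbb R$ and $g_i,h_i$ smooth. Let $d_i^0\in\mathbb R$ be given and let $y^*=(y_1^*,\dots,y_N^*)$ be the optimal solution of the problem of minimizing $\sum_{i}\frac12 y_i^2$ subject to $\sum_i y_i=\sum_i d_i^0$. Agent $i$ observes $d_i(t)=d_i^0+\sum_{j=1}^{k_i}A_{ij}\sin(\omega_{ij}t+\varphi_{ij})$ with known distinct frequencies $\omega_{ij}>0$ and unknown amplitudes $A_{ij}$ and phases $\varphi_{ij}$. Assume that for every $i$: (1) there is a unique pair of smooth functions $\mathbf x_i:\mathbb R\to\mathbb R^{n_i}$, $\mathbf u_i:\mathbb R\to\mathbb R$ with $g_i(\mathbf x_i(r),\mathbf u_i(r))=0$ and $h_i(\mathbf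 x_i(r))=r$ for all $r\in\mathbb R$, and $\mathbf u_i$ is $M_i$-Lipschitz on a set $C_i\subseteq\mathbb R$ with $y_i^*\in C_i$ (the concerned set; for example $C_i=\mathbb R$); (2) agent $i$ is passive with respect to $x_i^*=\mathbf x_i(y_i^*)$, $u_i^*=\mathbf u_i(y_i^*)$: there are a continuously differentiable function $V_i:\mathbb R^{n_i}\to\mathbb R$ and class $\mathcal K_\infty$ functions $\alpha_{i1},\alpha_{i2}$ with $\alpha_{i1}(\|x-x_i^*\|)\le V_i(x)\le\alpha_{i2}(\|x-x_i^*\|)$ and $\nabla V_i(x)^\top g_i(x,u)\le (h_i(x)-y_i^*)(u-u_i^*)$ for all $x\in\mathbb R^{n_i}$, $u\in\mathbb R$. Let $S_i=\mathrm{diag}\left(0,\begin{bmatrix}0&\omega_{i1}\\-\omega_{i1}&0\end{bmatrix},\dots,\begin{bmatrix}0&\omega_{ik_i}\\-\omega_{ik_i}&0\end{bmatrix}\right)$, $D_i=[1,1,0,\dots,1,0]$ and $D_i^\epsilon=[0,1,0,\dots,1,0]$ in $\mathbb R^{1\times(2k_i+1)}$, let $L_i\in\mathbb R^{2k_i+1}$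 be such that $S_i-L_iD_i$ is Hurwitz (all its eigenvalues have negative real part), and let $\gamma>1+\max_i M_i$. Consider the closed loop of the agents with the controller $$u_i=-\gamma y_i+\lambda_i+\mathbf u_i(y_i),\qquad \dot\lambda_i=-\lambda_i^v-z_i^v+d_i-y_i-D_i^\epsilon\eta_i,$$ $$\dot\eta_i=(S_i-L_iD_i)\eta_i+L_id_i,\qquad \dot z_i=\lambda_i^v,\qquad i=1,\dots,N.$$ Then for every initial state $(x,\lambda,\eta,z)(0)$ such that along the closed-loop solutions from it, as long as they exist, the outputs satisfy $y_i\in C_i$ for all $i$ (no restriction if $C_i=\mathbb R$), the closed loop has a solution on $[0,\infty)$, and along every such solution all $x_i$ are bounded and $$\lim_{t\to+\infty}y_i(t)=\frac1N\sum_{j=1}^N d_j^0,\qquad i=1,\dots,N.$$ In particular, if $d_j^0=y_j(0)$ for all $j$, then $y_i(t)\to\frac1N\sum_{j=1}^N y_j(0)$ for all $i$, so output average consensus is achieved despite the sinusoidal observation disturbances. -/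

import Mathlib

open Set Filter Topology
open scoped NNReal ContDiff Matrix

/-- A weighted undirected graph on the nodes `Fin N`, given by its adjacency weights. -/
structure WeightedGraph (N : ℕ) where
  weight : Fin N → Fin N → ℝ
  weight_self : ∀ i, weight i i = 0
  weight_symm : ∀ i j, weight i j = weight j i
  weight_nonneg : ∀ i j, 0 ≤ weight i j

/-- The underlying simple graph: `i` and `j` are joined iff the weight is positive. -/
def WeightedGraph.toSimpleGraph {N : ℕ} (G : WeightedGraph N) : SimpleGraph (Fin N) where
  Adj i j := 0 < G.weight i j
  symm := ⟨fun i j h => by rw [G.weight_symm j i]; exact h⟩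
  loopless := ⟨fun i h => by rw [G.weight_self i] at h; exact lt_irrefl 0 h⟩

/-- The local disagreement `∑ j, a i j * (v i - v j)`. -/
def WeightedGraph.disagreement {N : ℕ} (G : WeightedGraph N) (v : Fin N → ℝ) (i : Fin N) : ℝ :=
  ∑ j, G.weight i j * (v i - v j)

/-- A smooth single-input single-output agent `x' = g (x, u)`, `y = h x` with state in `ℝⁿ`. -/
structure Agent (n : ℕ) where
  g : EuclideanSpace ℝ (Fin n) → ℝ → EuclideanSpace ℝ (Fin n)
  h : EuclideanSpace ℝ (Fin n) → ℝ
  g_smooth : ContDiff ℝ ∞ (Function.uncurry g)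
  h_smooth : ContDiff ℝ ∞ h

/-- Smooth functions `X`, `U` that solve the regulator equations for every constant output `r`. -/
structure Agent.SolvesRegulator {n : ℕ} (P : Agent n)
    (X : ℝ → EuclideanSpace ℝ (Fin n)) (U : ℝ → ℝ) : Prop where
  smooth_state : ContDiff ℝ ∞ X
  smooth_input : ContDiff ℝ ∞ U
  equilibrium : ∀ r, P.g (X r) (U r) = 0
  output : ∀ r, P.h (X r) = r

/-- `(X, U)` is the unique pair of smooth functions that solves the regulator equations. -/
def Agent.IsRegulator {n : ℕ} (P : Agent n)
    (X : ℝ → EuclideanSpace ℝ (Fin n)) (U : ℝ → ℝ) : Prop :=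
  P.SolvesRegulator X U ∧ ∀ X' U', P.SolvesRegulator X' U' → X' = X ∧ U' = U

/-- Class `𝒦∞` comparison functions on `[0, ∞)`. -/
structure IsClassKInfty (α : ℝ → ℝ) : Prop where
  continuousOn : ContinuousOn α (Ici 0)
  strictMonoOn : StrictMonoOn α (Ici 0)
  map_zero : α 0 = 0
  tendsto_atTop : Tendsto α atTop atTop

/-- Passivity with respect to the equilibrium `(xs, us)`, with storage function `V`; the output
at the equilibrium is `P.h xs`. -/
def Agent.PassiveAt {n : ℕ} (P : Agent n) (xs : EuclideanSpace ℝ (Fin n)) (us : ℝ) : Prop :=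
  ∃ (V : EuclideanSpace ℝ (Fin n) → ℝ) (α₁ α₂ : ℝ → ℝ),
    ContDiff ℝ 1 V ∧ IsClassKInfty α₁ ∧ IsClassKInfty α₂ ∧
    (∀ x, α₁ ‖x - xs‖ ≤ V x ∧ V x ≤ α₂ ‖x - xs‖) ∧
    ∀ x u, fderiv ℝ V x (P.g x u) ≤ (P.h x - P.h xs) * (u - us)

/-- `y` minimizes `∑ i, f i (y i)` subject to `∑ i, y i = ∑ i, d i`. -/
def IsOptimalAllocation {N : ℕ} (f : Fin N → ℝ → ℝ) (d y : Fin N → ℝ) : Prop :=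
  ∑ i, y i = ∑ i, d i ∧
    ∀ y' : Fin N → ℝ, ∑ i, y' i = ∑ i, d i → ∑ i, f i (y i) ≤ ∑ i, f i (y' i)

/-- Coordinates of the observer state in `ℝ^(2k+1)`: one constant mode and `k` planar modes. -/
abbrev ObsIndex (k : ℕ) : Type := Unit ⊕ (Fin 2 × Fin k)

/-- The block diagonal matrix with blocks `0` and `[0, freq j; -freq j, 0]`, `j = 1, …, k`. -/
def exoMatrix {k : ℕ} (freq : Fin k → ℝ) : Matrix (ObsIndex k) (ObsIndex k) ℝ :=
  Matrix.fromBlocks 0 0 0 (Matrix.blockDiagonal fun j => !![0, freq j; -freq j, 0])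

/-- The row `[1, 1, 0, …, 1, 0]`. -/
def obsRow (k : ℕ) : ObsIndex k → ℝ :=
  Sum.elim (fun _ => 1) (fun p => if p.1 = 0 then 1 else 0)

/-- The row `[1, 0, …, 1, 0]` of the disturbance modes; it does not see the constant mode, so its
entry there is `0`. -/
def distRow (k : ℕ) : ObsIndex k → ℝ :=
  Sum.elim (fun _ => 0) (fun p => if p.1 = 0 then 1 else 0)

/-- The observer matrix `S - L D`. -/
def observerMatrix {k : ℕ} (freq : Fin k → ℝ) (L : ObsIndex k → ℝ) :
    Matrix (ObsIndex k) (ObsIndex k) ℝ :=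
  exoMatrix freq - Matrix.vecMulVec L (obsRow k)

/-- All complex eigenvalues have negative real part. -/
def IsHurwitz {ι : Type} [Fintype ι] [DecidableEq ι] (A : Matrix ι ι ℝ) : Prop :=
  ∀ μ ∈ spectrum ℂ (A.map ((↑) : ℝ → ℂ)), μ.re < 0

/-- The observation `d(t) = d⁰ + ∑ j, A j * sin (freq j * t + φ j)`. -/
noncomputable def observation {k : ℕ} (d₀ : ℝ) (freq amp phase : Fin k → ℝ) (t : ℝ) : ℝ :=
  d₀ + ∑ j, amp j * Real.sin (freq j * t + phase j)

/-- States `(x, lam, η, z)` of the closed loop. -/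
abbrev LoopState {N : ℕ} (n k : Fin N → ℕ) : Type :=
  (∀ i, EuclideanSpace ℝ (Fin (n i))) × (Fin N → ℝ) × (∀ i, ObsIndex (k i) → ℝ) × (Fin N → ℝ)

/-- The right-hand side of the closed loop. `U` are the feedforward inputs, `d` the polluted
observations, `L` the observer gains:
`u = -γ y + lam + U y`, `lam' = -lamᵛ - zᵛ + d - y - Dᵋ η`, `η' = (S - L D) η + L d`,
`z' = lamᵛ`. -/
noncomputable def loopField {N : ℕ} (G : WeightedGraph N) {n k : Fin N → ℕ}
    (P : ∀ i, Agent (n i)) (U : Fin N → ℝ → ℝ) (freq : ∀ i, Fin (k i) → ℝ)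
    (L : ∀ i, ObsIndex (k i) → ℝ) (γ : ℝ) (d : Fin N → ℝ → ℝ) (t : ℝ) :
    LoopState n k → LoopState n k
  | (x, lam, η, z) =>
    (fun i => (P i).g (x i) (-γ * (P i).h (x i) + lam i + U i ((P i).h (x i))),
     fun i => -G.disagreement lam i - G.disagreement z i + d i t - (P i).h (x i)
        - distRow (k i) ⬝ᵥ η i,
     fun i => observerMatrix (freq i) (L i) *ᵥ η i + d i t • L i,
     fun i => G.disagreement lam i)

/-- `w` solves `w' = F t w` on the time set `I` (one-sided derivatives at end points). -/
def SolvesOn {E : Type} [NormedAddCommGroup E] [NormedSpace ℝ E]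
    (F : ℝ → E → E) (I : Set ℝ) (w : ℝ → E) : Prop :=
  ∀ t ∈ I, HasDerivWithinAt w (F t (w t)) I t

/-! The proof is a Lyapunov argument with an exponentially decaying perturbation. The optimum `y*`
is the average of the `d₀ i`, hence a consensus vector. The target values are `lam* = γ y*`, which
has zero disagreement, and a `z*` whose disagreement is `d₀ - y*`; the latter exists because `d₀ -
y*` has sum zero and the Laplacian of a connected graph is self-adjoint with the constants as
kernel.

Take as storage `∑ (V i + |lam - lam*|²/2 + |z - z*|²/2 + 1/2)`. Passivity and the Lipschitz bound
give `(M - γ)(y - y*)² + (y - y*)(lam - lam*)`, whose cross term is cancelled by the `lam` dynamics.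
The exchange between `lam` and `z` cancels because the Laplacian is symmetric, and the remaining
Laplacian term has a sign. What is left over is `lam - lam*` times the estimation error of the
disturbance, which is `O(exp (-b t))` because the observer matrix is Hurwitz. So `W' ≤ -∑ (y - y*)²
+ κ exp (-b t) W`, and a bounded integrating factor turns `W` into a decreasing function
(`loopStorageDeriv_le`, `exists_hasDerivWithinAt_mul_exp_le`).

This bounds every solution independently of the time horizon, hence gives global existence
(`exists_solvesOn_Ici_of_bounded`). It also makes `(y - y*)²` integrable, and since `y'` is bounded,
a Barbalat argument (`tendsto_zero_of_deriv_le_neg_sq`) yields `y → y*`. -/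

/-! ### Exponential decay for Hurwitz linear systems -/

/-- A curve with `v' = μ v + r`, where `r` decays at a rate slower than `-μ.re`, decays
at the rate of `r`. -/
theorem norm_le_of_hasDerivWithinAt_smul_add {E : Type*} [NormedAddCommGroup E] [NormedSpace ℂ E]
    {μ : ℂ} {b K T : ℝ} (hK : 0 ≤ K) (hμ : b < -μ.re) {v r : ℝ → E}
    (hv : ∀ t ∈ Icc 0 T, HasDerivWithinAt v (μ • v t + r t) (Icc 0 T) t)
    (hr : ∀ t ∈ Icc 0 T, ‖r t‖ ≤ K * Real.exp (-b * t)) {t : ℝ} (ht : t ∈ Icc 0 T) :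
    ‖v t‖ ≤ (‖v 0‖ + K / (-μ.re - b)) * Real.exp (-b * t) := by
  set δ : ℝ := -μ.re - b with hδ
  have hδ0 : 0 < δ := by linarith
  have hexp : ∀ s : ℝ, HasDerivAt (fun s : ℝ => Complex.exp (-μ * s))
      (Complex.exp (-μ * s) * (-μ)) s := fun s => by
    have h1 : HasDerivAt (fun s : ℝ => -μ * (s : ℂ)) (-μ * 1) s :=
      (Complex.ofRealCLM.hasDerivAt (x := s)).const_mul (-μ)
    simpa using h1.cexp
  have hnexp : ∀ s : ℝ, ‖Complex.exp (-μ * s)‖ = Real.exp (-μ.re * s) := fun s => by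
    rw [Complex.norm_exp]; simp
  -- The integrating factor removes the term `μ v`; what remains has norm at most `K exp (δ s)`,
  -- whose antiderivative is the comparison function below.
  have hq : ∀ s ∈ Icc 0 T, HasDerivWithinAt (fun s : ℝ => Complex.exp (-μ * s) • v s)
      (Complex.exp (-μ * s) • r s) (Icc 0 T) s := fun s hs => by
    have := (hexp s).hasDerivWithinAt.smul (hv s hs)
    refine this.congr_deriv ?_
    module
  have hB : ∀ s : ℝ, HasDerivAt (fun s : ℝ => ‖v 0‖ + K / δ * Real.exp (δ * s) )
      (K * Real.exp (δ * s)) s := fun s => by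
    have h1 : HasDerivAt (fun s : ℝ => δ * s) (δ * 1) s := (hasDerivAt_id s).const_mul δ
    refine ((h1.exp.const_mul (K / δ)).const_add (‖v 0‖)).congr_deriv ?_
    field_simp
  have key := image_norm_le_of_norm_deriv_right_le_deriv_boundary (a := 0) (b := T)
    (fun s hs => (hq s hs).continuousWithinAt)
    (fun s hs => (hq s (Ico_subset_Icc_self hs)).mono_of_mem_nhdsWithin
      (Icc_mem_nhdsGE_of_mem hs)) (B := fun s : ℝ => ‖v 0‖ + K / δ * Real.exp (δ * s))
    (by simp; positivity) hB (fun s hs => by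
      rw [norm_smul, hnexp]
      calc _ ≤ Real.exp (-μ.re * s) * (K * Real.exp (-b * s)) := by
            gcongr; exact hr s (Ico_subset_Icc_self hs)
        _ = K * (Real.exp (-μ.re * s) * Real.exp (-b * s)) := by ring
        _ = K * Real.exp (δ * s) := by rw [← Real.exp_add]; congr 2; rw [hδ]; ring) ht
  rw [norm_smul, hnexp] at key
  have e1 : Real.exp (μ.re * t) * Real.exp (-μ.re * t) = 1 := by
    rw [← Real.exp_add]; simp
  have e2 : Real.exp (μ.re * t) * Real.exp (δ * t) = Real.exp (-b * t) := by
    rw [← Real.exp_add]; congr 1; rw [hδ]; ring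
  calc ‖v t‖ = Real.exp (μ.re * t) * (Real.exp (-μ.re * t) * ‖v t‖) := by
        rw [← mul_assoc, e1, one_mul]
    _ ≤ Real.exp (μ.re * t) * (‖v 0‖ + K / δ * Real.exp (δ * t)) := by gcongr
    _ = ‖v 0‖ * Real.exp (μ.re * t) + K / δ * Real.exp (-b * t) := by rw [← e2]; ring
    _ ≤ ‖v 0‖ * Real.exp (-b * t) + K / δ * Real.exp (-b * t) := by
        gcongr
        · exact ht.1
        · linarith
    _ = _ := by ring

/-- Solutions of `v' = A v` that are annihilated by `∏ (A - μ)` with all `μ.re < 0` decay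
exponentially, uniformly in the length of the time interval. -/
theorem exists_decay_of_prod_sub_mulVec_eq_zero {ι : Type*} [Fintype ι] [DecidableEq ι]
    (A : Matrix ι ι ℂ) (l : List ℂ) (hl : ∀ μ ∈ l, μ.re < 0) :
    ∃ b K : ℝ, 0 < b ∧ 0 ≤ K ∧ ∀ (T : ℝ) (v : ℝ → ι → ℂ),
      (∀ t ∈ Icc 0 T, HasDerivWithinAt v (A *ᵥ v t) (Icc 0 T) t) →
      (∀ t ∈ Icc 0 T, (l.map fun μ => A - μ • (1 : Matrix ι ι ℂ)).prod *ᵥ v t = 0) →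
      ∀ t ∈ Icc 0 T, ‖v t‖ ≤ K * ‖v 0‖ * Real.exp (-b * t) := by
  -- Peel off one factor `Q = A - μ`. It commutes with `A`, so `Q v` solves the same equation and is
  -- annihilated by the remaining product; it decays by induction, and `v' = μ v + Q v`.
  induction l with
  | nil =>
    refine ⟨1, 0, one_pos, le_rfl, fun T v _ h0 t ht => ?_⟩
    have := h0 t ht
    simp at this
    simp [this]
  | cons μ l ih =>
    obtain ⟨b, K, hb, hK, h⟩ := ih fun ν hν => hl ν (by simp [hν])
    have hμ : μ.re < 0 := hl μ (by simp)
    set Q : Matrix ι ι ℂ := A - μ • (1 : Matrix ι ι ℂ) with hQ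
    set Qc : (ι → ℂ) →L[ℂ] (ι → ℂ) := LinearMap.toContinuousLinearMap (Matrix.mulVecLin Q) with hQc
    have hQv : ∀ x, Qc x = Q *ᵥ x := fun x => rfl
    have hcomm : Commute Q A := by
      rw [hQ]
      exact (Commute.refl A).sub_left ((Commute.one_left A).smul_left μ)
    have hcommp : Commute Q (l.map fun μ => A - μ • (1 : Matrix ι ι ℂ)).prod := by
      refine Commute.list_prod_right _ _ fun B hB => ?_
      obtain ⟨ν, -, rfl⟩ := List.mem_map.1 hB
      exact hcomm.sub_right ((Commute.one_right Q).smul_right ν)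
    -- The rate is kept strictly below `-μ.re`: repeated eigenvalues produce polynomial factors,
    -- which the loss of rate absorbs.
    set b' := min b (-μ.re / 2) with hb'
    have hb'0 : 0 < b' := lt_min hb (by linarith)
    have hb'μ : b' < -μ.re := (min_le_right _ _).trans_lt (by linarith)
    refine ⟨b', 1 + K * ‖Qc‖ / (-μ.re - b'), hb'0, ?_, fun T v hv h0 t ht => ?_⟩
    · have : 0 < -μ.re - b' := by linarith
      positivity
    have hr := h T (fun s => Q *ᵥ v s) (fun s hs => by
        have := (Qc.restrictScalars ℝ).hasFDerivAt.comp_hasDerivWithinAt s (hv s hs)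
        refine this.congr_deriv ?_
        change Q *ᵥ (A *ᵥ v s) = _
        rw [Matrix.mulVec_mulVec, Matrix.mulVec_mulVec, hcomm.eq])
      (fun s hs => by
        have := h0 s hs
        rw [List.map_cons, List.prod_cons, hcommp.eq, ← Matrix.mulVec_mulVec] at this
        exact this)
    have := norm_le_of_hasDerivWithinAt_smul_add (μ := μ) (b := b') (K := K * (‖Qc‖ * ‖v 0‖))
      (T := T) (by positivity) hb'μ (v := v) (r := fun s => Q *ᵥ v s)
      (fun s hs => by
        refine (hv s hs).congr_deriv ?_
        simp [hQ, Matrix.sub_mulVec, Matrix.smul_mulVec])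
      (fun s hs => by
        refine (hr s hs).trans ?_
        have h1 : ‖Q *ᵥ v 0‖ ≤ ‖Qc‖ * ‖v 0‖ := Qc.le_opNorm (v 0)
        have h2 : b' ≤ b := min_le_left _ _
        have h3 := hs.1
        gcongr) ht
    refine this.trans (le_of_eq ?_)
    ring

/-- Solutions of `e' = A e` with `A` Hurwitz decay exponentially. -/
theorem IsHurwitz.exists_decay {ι : Type} [Fintype ι] [DecidableEq ι] {A : Matrix ι ι ℝ}
    (hA : IsHurwitz A) :
    ∃ b K : ℝ, 0 < b ∧ 0 ≤ K ∧ ∀ (T : ℝ) (e : ℝ → ι → ℝ),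
      (∀ t ∈ Icc 0 T, HasDerivWithinAt e (A *ᵥ e t) (Icc 0 T) t) →
      ∀ t ∈ Icc 0 T, ‖e t‖ ≤ K * ‖e 0‖ * Real.exp (-b * t) := by
  set Ac : Matrix ι ι ℂ := A.map ((↑) : ℝ → ℂ) with hAc
  obtain ⟨b, K, hb, hK, h⟩ := exists_decay_of_prod_sub_mulVec_eq_zero Ac Ac.charpoly.roots.toList
    (fun μ hμ => hA μ (by
      rw [Multiset.mem_toList, Polynomial.mem_roots (Matrix.charpoly_monic _).ne_zero] at hμ
      exact Matrix.mem_spectrum_iff_isRoot_charpoly.2 hμ))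
  -- Cayley–Hamilton over `ℂ`, where the characteristic polynomial splits; this replaces a Jordan
  -- form.
  have hprod : (Ac.charpoly.roots.toList.map fun μ => Ac - μ • (1 : Matrix ι ι ℂ)).prod = 0 := by
    have h1 := Matrix.aeval_self_charpoly Ac
    have h2 : Ac.charpoly =
        (Ac.charpoly.roots.toList.map fun μ => Polynomial.X - Polynomial.C μ).prod := by
      conv_lhs => rw [(IsAlgClosed.splits Ac.charpoly).eq_prod_roots_of_monic
        (Matrix.charpoly_monic _), ← Multiset.coe_toList Ac.charpoly.roots]
      rw [Multiset.map_coe, Multiset.prod_coe]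
    rw [h2, map_list_prod, List.map_map] at h1
    rw [← h1]
    congr 2
    funext μ
    simp [Algebra.algebraMap_eq_smul_one]
  refine ⟨b, K, hb, hK, fun T e he t ht => ?_⟩
  have hn : ∀ x : ι → ℝ, ‖fun i => (x i : ℂ)‖ = ‖x‖ := fun x => by
    simp [Pi.norm_def]
  have := h T (fun t i => (e t i : ℂ)) (fun s hs => by
      rw [hasDerivWithinAt_pi]
      intro i
      have := (hasDerivWithinAt_pi.1 (he s hs) i).ofReal_comp
      refine this.congr_deriv ?_
      simp [Matrix.mulVec, dotProduct, hAc])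
    (fun s _ => by rw [hprod, Matrix.zero_mulVec]) t ht
  rwa [hn, hn] at this

/-! ### Global existence of solutions -/

theorem SolvesOn.mono {E : Type} [NormedAddCommGroup E] [NormedSpace ℝ E] {F : ℝ → E → E}
    {I J : Set ℝ} {w : ℝ → E} (h : SolvesOn F J w) (hIJ : I ⊆ J) : SolvesOn F I w :=
  fun t ht => (h t (hIJ ht)).mono hIJ

theorem SolvesOn.eqOn_Icc {E : Type} [NormedAddCommGroup E] [NormedSpace ℝ E] {F : ℝ → E → E}
    {K : ℝ≥0} (hF : ∀ t, LipschitzWith K (F t)) {T : ℝ} {v w : ℝ → E}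
    (hv : SolvesOn F (Icc 0 T) v) (hw : SolvesOn F (Icc 0 T) w) (h0 : v 0 = w 0) :
    EqOn v w (Icc 0 T) :=
  ODE_solution_unique_of_mem_Icc_right (s := fun _ => univ) (K := K) (v := F)
    (fun t _ => (hF t).lipschitzOnWith)
    (fun s hs => (hv s hs).continuousWithinAt)
    (fun s hs => (hv s (Ico_subset_Icc_self hs)).mono_of_mem_nhdsWithin
      (Icc_mem_nhdsGE_of_mem hs)) (fun _ _ => mem_univ _)
    (fun s hs => (hw s hs).continuousWithinAt)
    (fun s hs => (hw s (Ico_subset_Icc_self hs)).mono_of_mem_nhdsWithin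
      (Icc_mem_nhdsGE_of_mem hs)) (fun _ _ => mem_univ _) h0

/-- A bounded field that is globally Lipschitz in the state has global forward solutions. -/
theorem exists_solvesOn_Ici_of_lipschitzWith {E : Type} [NormedAddCommGroup E] [NormedSpace ℝ E]
    [CompleteSpace E] {F : ℝ → E → E} {K C : ℝ≥0} (hF : ∀ t, LipschitzWith K (F t))
    (hc : ∀ x, Continuous fun t => F t x) (hC : ∀ t x, ‖F t x‖ ≤ C) (w₀ : E) :
    ∃ w : ℝ → E, w 0 = w₀ ∧ SolvesOn F (Ici 0) w := by
  have hex : ∀ m : ℕ, ∃ w : ℝ → E, w 0 = w₀ ∧ SolvesOn F (Icc 0 (m : ℝ)) w := fun m => by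
    -- The field is bounded by `C`, so a ball of radius `C * m` cannot be left before time `m`, and
    -- one Picard–Lindelöf step covers `[0, m]`.
    have hP : IsPicardLindelof F (tmin := 0) (tmax := (m : ℝ)) ⟨0, le_rfl, Nat.cast_nonneg m⟩ w₀
        (C * m) 0 C K :=
      { lipschitzOnWith := fun t _ => (hF t).lipschitzOnWith
        continuousOn := fun x _ => (hc x).continuousOn
        norm_le := fun t _ x _ => hC t x
        mul_max_le := by simp }
    exact hP.exists_eq_forall_mem_Icc_hasDerivWithinAt₀
  choose w hw0 hw using hex
  have hagree : ∀ {m m' : ℕ} {t : ℝ}, 0 ≤ t → t ≤ m → t ≤ m' → w m t = w m' t := by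
    intro m m' t ht hm hm'
    exact SolvesOn.eqOn_Icc hF ((hw m).mono (Icc_subset_Icc_right hm))
      ((hw m').mono (Icc_subset_Icc_right hm')) ((hw0 m).trans (hw0 m').symm) ⟨ht, le_rfl⟩
  refine ⟨fun t => w ⌈t⌉₊ t, by simp [hw0], fun t ht => ?_⟩
  -- The extra `1` makes the horizon exceed `t` strictly, even at integers, so that a single
  -- solution represents the glued curve in a neighbourhood of `t`.
  set m : ℕ := ⌈t⌉₊ + 1 with hm
  have htm : t < m := by
    have := Nat.le_ceil t
    rw [hm]; push_cast; linarith
  have h1 : HasDerivWithinAt (w m) (F t (w m t)) (Ici 0) t := by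
    refine ((hw m) t ⟨ht, htm.le⟩).mono_of_mem_nhdsWithin ?_
    rw [← Ici_inter_Iic]
    exact inter_mem self_mem_nhdsWithin (mem_nhdsWithin_of_mem_nhds (Iic_mem_nhds htm))
  have h2 : w ⌈t⌉₊ t = w m t := hagree ht (Nat.le_ceil t) htm.le
  simp only [h2]
  refine h1.congr_of_eventuallyEq ?_ h2
  filter_upwards [self_mem_nhdsWithin, mem_nhdsWithin_of_mem_nhds (Iio_mem_nhds htm)] with s hs hsm
  exact hagree hs (Nat.le_ceil s) (le_of_lt hsm)

/-- A field `F₀ w + B t` with `F₀` of class `C¹` and `B` bounded and continuous has a global forward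
solution if all its solutions on compact intervals obey one a priori bound. -/
theorem exists_solvesOn_Ici_of_bounded {E : Type} [NormedAddCommGroup E] [NormedSpace ℝ E]
    [FiniteDimensional ℝ E] {F₀ : E → E} {B : ℝ → E} (hF₀ : ContDiff ℝ 1 F₀) (hB : Continuous B)
    {β : ℝ} (hβ : ∀ t, ‖B t‖ ≤ β) {w₀ : E} {R : ℝ}
    (hR : ∀ (T : ℝ) (w : ℝ → E), w 0 = w₀ → SolvesOn (fun t w => F₀ w + B t) (Icc 0 T) w →
      ∀ t ∈ Icc 0 T, ‖w t‖ ≤ R) :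
    ∃ w : ℝ → E, w 0 = w₀ ∧ SolvesOn (fun t w => F₀ w + B t) (Ici 0) w := by
  have : CompleteSpace E := FiniteDimensional.complete ℝ E
  -- Cutting `F₀` off outside radius `R' + 2` gives a bounded, globally Lipschitz field. The maximum
  -- with `‖w₀‖` places the initial state strictly inside the region where nothing is changed.
  set R' := max R ‖w₀‖ with hR'
  have hR'0 : 0 ≤ R' := (norm_nonneg w₀).trans (le_max_right _ _)
  let χ : ContDiffBump (0 : E) := ⟨R' + 1, R' + 2, by linarith, by linarith⟩
  set H : E → E := fun x => χ x • F₀ x with hH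
  have hHc : ContDiff ℝ 1 H := (χ.contDiff).smul hF₀
  have hHs : HasCompactSupport H := χ.hasCompactSupport.smul_right
  obtain ⟨K, hK⟩ := (hHs.fderiv (𝕜 := ℝ)).exists_bound_of_continuous
    (hHc.continuous_fderiv one_ne_zero)
  obtain ⟨c, hc⟩ := hHs.exists_bound_of_continuous hHc.continuous
  have hlip : LipschitzWith K.toNNReal H :=
    lipschitzWith_of_nnnorm_fderiv_le (𝕜 := ℝ) (hHc.differentiable one_ne_zero) fun x => by
      rw [← NNReal.coe_le_coe, Real.coe_toNNReal', coe_nnnorm]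
      exact (hK x).trans (le_max_left _ _)
  obtain ⟨w, hw0, hw⟩ := exists_solvesOn_Ici_of_lipschitzWith (F := fun t x => H x + B t)
    (K := K.toNNReal) (C := (c + β).toNNReal)
    (fun t => by simpa using hlip.add (LipschitzWith.const (B t)))
    (fun x => by fun_prop)
    (fun t x => by
      refine ((norm_add_le _ _).trans (add_le_add (hc x) (hβ t))).trans ?_
      exact Real.le_coe_toNNReal _) w₀
  have hHeq : ∀ x, ‖x‖ ≤ R' + 1 → H x = F₀ x := fun x hx => by
    have : χ x = 1 := χ.one_of_mem_closedBall (by simpa using hx)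
    simp [hH, this]
  have hcont : ContinuousOn (fun t => ‖w t‖) (Ici 0) :=
    fun t ht => (hw t ht).continuousWithinAt.norm
  have hbound : ∀ t, 0 ≤ t → ‖w t‖ < R' + 1 := by
    by_contra! hcon
    obtain ⟨t₁, ht₁, hwt₁⟩ := hcon
    -- Up to the first time `τ` at which the norm reaches `R' + 1`, the curve solves the original
    -- equation, so the a priori bound gives `‖w τ‖ ≤ R`, a contradiction.
    set S : Set ℝ := Icc 0 t₁ ∩ (fun t => ‖w t‖) ⁻¹' Ici (R' + 1) with hS
    have hScl : IsClosed S :=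
      (hcont.mono Icc_subset_Ici_self).preimage_isClosed_of_isClosed isClosed_Icc isClosed_Ici
    have hSne : S.Nonempty := ⟨t₁, ⟨ht₁, le_rfl⟩, hwt₁⟩
    have hSbdd : BddBelow S := ⟨0, fun s hs => hs.1.1⟩
    set τ := sInf S with hτ
    have hτS : τ ∈ S := hScl.csInf_mem hSne hSbdd
    have hlt : ∀ s ∈ Ico 0 τ, ‖w s‖ < R' + 1 := fun s hs => by
      by_contra! h
      exact absurd (csInf_le hSbdd (⟨⟨hs.1, hs.2.le.trans hτS.1.2⟩, h⟩ : s ∈ S)) (not_le.2 hs.2)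
    have hτ0 : 0 < τ := by
      rcases hτS.1.1.eq_or_lt with h | h
      · exfalso
        have h1 : R' + 1 ≤ ‖w τ‖ := hτS.2
        rw [← h, hw0] at h1
        have := le_max_right R ‖w₀‖
        linarith
      · exact h
    have hle : ∀ s ∈ Icc 0 τ, ‖w s‖ ≤ R' + 1 := by
      have : closure (Ico 0 τ) = Icc 0 τ := closure_Ico hτ0.ne
      intro s hs
      exact ContinuousWithinAt.closure_le (by rw [this]; exact hs)
        ((hcont s hs.1).mono Ico_subset_Ici_self)
        continuousWithinAt_const fun r hr => (hlt r hr).le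
    have h1 := hR τ w hw0 (fun s hs => by
      have := (hw s hs.1).mono (Icc_subset_Ici_self : Icc 0 τ ⊆ Ici 0)
      simpa only [hHeq _ (hle s hs)] using this) τ ⟨hτ0.le, le_rfl⟩
    have h2 : R' + 1 ≤ ‖w τ‖ := hτS.2
    have := le_max_left R ‖w₀‖
    linarith
  exact ⟨w, hw0, fun t ht => by simpa only [hHeq _ (hbound t ht).le] using hw t ht⟩

/-! ### A Barbalat-type lemma -/

/-- A curve whose squared norm is controlled by the decrease of a nonnegative function, and whose
derivative is bounded, tends to zero. -/
theorem tendsto_zero_of_deriv_le_neg_sq {f W : ℝ → ℝ} {f' W' : ℝ → ℝ} {c K : ℝ} (hc : 0 < c)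
    (hf : ∀ t, 0 ≤ t → HasDerivWithinAt f (f' t) (Ici 0) t) (hf' : ∀ t, 0 ≤ t → |f' t| ≤ K)
    (hW : ∀ t, 0 ≤ t → HasDerivWithinAt W (W' t) (Ici 0) t)
    (hW' : ∀ t, 0 ≤ t → W' t ≤ -c * f t ^ 2) (hW0 : ∀ t, 0 ≤ t → 0 ≤ W t) :
    Tendsto f atTop (𝓝 0) := by
  have hWc : ContinuousOn W (Ici 0) := fun t ht => (hW t ht).continuousWithinAt
  have hWderiv : ∀ t, 0 < t → HasDerivAt W (W' t) t := fun t ht =>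
    (hW t ht.le).hasDerivAt (Ici_mem_nhds ht)
  have hanti : AntitoneOn W (Ici 0) := antitoneOn_of_deriv_nonpos (convex_Ici 0) hWc
    (fun t ht => by
      rw [interior_Ici] at ht
      exact (hWderiv t ht).differentiableAt.differentiableWithinAt)
    (fun t ht => by
      rw [interior_Ici] at ht
      rw [(hWderiv t ht).deriv]
      have := hW' t (le_of_lt ht)
      have := sq_nonneg (f t)
      nlinarith)
  set W₁ := sInf (W '' Ici 0) with hW₁
  have hbdd : BddBelow (W '' Ici 0) := ⟨0, by rintro _ ⟨t, ht, rfl⟩; exact hW0 t ht⟩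
  have hflip : ∀ s t, 0 ≤ s → 0 ≤ t → |f t - f s| ≤ K * |t - s| := fun s t hs ht => by
    have := (convex_Ici (0 : ℝ)).norm_image_sub_le_of_norm_hasDerivWithin_le (f := f) (f' := f')
      (C := K) (fun x hx => hf x hx) (fun x hx => hf' x hx) (mem_Ici.2 hs) (mem_Ici.2 ht)
    simpa using this
  have hK : 0 ≤ K := (abs_nonneg _).trans (hf' 0 le_rfl)
  rw [Metric.tendsto_atTop]
  intro ε hε
  -- Over a time `δ` the curve `f` moves by at most `ε / 2`; `K + 1` avoids division by zero.
  set δ := ε / (2 * (K + 1)) with hδ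
  have hδ0 : 0 < δ := by positivity
  have hgain : 0 < c * (ε / 2) ^ 2 * δ := by positivity
  -- From `t₀` on, `W` is too close to its infimum to drop by `c (ε / 2)² δ`, which `ε ≤ |f t|`
  -- would force on `[t, t + δ]`.
  obtain ⟨_, ⟨t₀, ht₀, rfl⟩, hlt⟩ := exists_lt_of_csInf_lt (s := W '' Ici 0) ⟨W 0, 0, self_mem_Ici, rfl⟩
    (show sInf (W '' Ici 0) < W₁ + c * (ε / 2) ^ 2 * δ by linarith)
  refine ⟨t₀, fun t ht => ?_⟩
  rw [Real.dist_eq, sub_zero]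
  by_contra! hcon
  have ht0 : 0 ≤ t := le_trans ht₀ ht
  have hlow : ∀ s ∈ Icc t (t + δ), ε / 2 ≤ |f s| := fun s hs => by
    have h1 := hflip t s ht0 (ht0.trans hs.1)
    rw [abs_of_nonneg (by linarith [hs.1] : 0 ≤ s - t)] at h1
    have h2 : K * (s - t) ≤ ε / 2 := by
      calc K * (s - t) ≤ (K + 1) * δ := by
            have := hs.1; have := hs.2
            gcongr <;> linarith
        _ = ε / 2 := by rw [hδ]; field_simp
    have h3 := abs_sub_abs_le_abs_sub (f t) (f s)
    rw [abs_sub_comm] at h3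
    linarith
  have hdec : W (t + δ) - W t ≤ -(c * (ε / 2) ^ 2) * (t + δ - t) := by
    refine (convex_Icc t (t + δ)).image_sub_le_mul_sub_of_deriv_le
      (hWc.mono fun s hs => ht0.trans hs.1) (fun s hs => ?_) (fun s hs => ?_) t
      (left_mem_Icc.2 (by linarith)) (t + δ) (right_mem_Icc.2 (by linarith)) (by linarith)
    · rw [interior_Icc] at hs
      exact (hWderiv s (ht0.trans_lt hs.1)).differentiableAt.differentiableWithinAt
    · rw [interior_Icc] at hs
      have hs0 : 0 < s := ht0.trans_lt hs.1
      rw [(hWderiv s hs0).deriv]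
      have h1 := hW' s hs0.le
      have h2 : (ε / 2) ^ 2 ≤ f s ^ 2 := by
        rw [← sq_abs (f s)]
        have := hlow s ⟨hs.1.le, hs.2.le⟩
        gcongr
      nlinarith
  have h1 : W t ≤ W t₀ := hanti ht₀ ht0 ht
  have h2 : W₁ ≤ W (t + δ) := csInf_le hbdd ⟨t + δ, by simp only [mem_Ici]; linarith, rfl⟩
  have h3 : -(c * (ε / 2) ^ 2) * (t + δ - t) = -(c * (ε / 2) ^ 2 * δ) := by ring
  linarith

/-! ### The graph Laplacian -/

namespace WeightedGraph

variable {N : ℕ} (G : WeightedGraph N)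

theorem disagreement_sub (v w : Fin N → ℝ) (i : Fin N) :
    G.disagreement (fun j => v j - w j) i = G.disagreement v i - G.disagreement w i := by
  simp only [disagreement, ← Finset.sum_sub_distrib]
  exact Finset.sum_congr rfl fun j _ => by ring

theorem disagreement_const (c : ℝ) (i : Fin N) : G.disagreement (fun _ => c) i = 0 := by
  simp [disagreement]

/-- The quadratic form of the Laplacian, symmetrized. -/
theorem sum_mul_disagreement (v w : Fin N → ℝ) :
    ∑ i, v i * G.disagreement w i =
      (1 / 2) * ∑ i, ∑ j, G.weight i j * ((v i - v j) * (w i - w j)) := by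
  have h1 : ∑ i, v i * G.disagreement w i = ∑ i, ∑ j, G.weight i j * (v i * (w i - w j)) :=
    Finset.sum_congr rfl fun i _ => by
      rw [disagreement, Finset.mul_sum]
      exact Finset.sum_congr rfl fun j _ => by ring
  have h2 : ∑ i, ∑ j, G.weight i j * (v i * (w i - w j)) =
      ∑ i, ∑ j, G.weight i j * (v j * (w j - w i)) := by
    rw [Finset.sum_comm]
    exact Finset.sum_congr rfl fun i _ => Finset.sum_congr rfl fun j _ => by
      rw [G.weight_symm j i]
  have h3 : ∑ i, ∑ j, G.weight i j * ((v i - v j) * (w i - w j)) =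
      ∑ i, ∑ j, G.weight i j * (v i * (w i - w j)) +
        ∑ i, ∑ j, G.weight i j * (v j * (w j - w i)) := by
    simp only [← Finset.sum_add_distrib]
    exact Finset.sum_congr rfl fun i _ => Finset.sum_congr rfl fun j _ => by ring
  rw [h1, h3, ← h2]; ring

/-- Self-adjointness of the Laplacian. It cancels the exchange between `lam` and `z` in the storage
balance, and it identifies the range of the Laplacian with the orthogonal complement of its kernel.
-/
theorem sum_mul_disagreement_comm (v w : Fin N → ℝ) :
    ∑ i, v i * G.disagreement w i = ∑ i, w i * G.disagreement v i := by
  rw [sum_mul_disagreement, sum_mul_disagreement]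
  simp only [mul_comm]

theorem sum_mul_disagreement_nonneg (v : Fin N → ℝ) : 0 ≤ ∑ i, v i * G.disagreement v i := by
  rw [sum_mul_disagreement]
  have : 0 ≤ ∑ i, ∑ j, G.weight i j * ((v i - v j) * (v i - v j)) :=
    Finset.sum_nonneg fun i _ => Finset.sum_nonneg fun j _ =>
      mul_nonneg (G.weight_nonneg i j) (mul_self_nonneg _)
  linarith

/-- On a connected graph, only the constants have zero disagreement. -/
theorem eq_of_disagreement_eq_zero (hG : G.toSimpleGraph.Connected) {v : Fin N → ℝ}
    (hv : ∀ i, G.disagreement v i = 0) (i j : Fin N) : v i = v j := by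
  have h0 : ∑ i, ∑ j, G.weight i j * ((v i - v j) * (v i - v j)) = 0 := by
    have := G.sum_mul_disagreement v v
    simp only [hv, mul_zero, Finset.sum_const_zero] at this
    linarith
  have hadj : ∀ a b, G.toSimpleGraph.Adj a b → v a = v b := fun a b hab => by
    have hnn : ∀ i j, 0 ≤ G.weight i j * ((v i - v j) * (v i - v j)) := fun i j =>
      mul_nonneg (G.weight_nonneg i j) (mul_self_nonneg _)
    have h1 := (Finset.sum_eq_zero_iff_of_nonneg
      (fun i _ => Finset.sum_nonneg fun j _ => hnn i j)).1 h0 a (Finset.mem_univ a)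
    have h2 := (Finset.sum_eq_zero_iff_of_nonneg (fun j _ => hnn a j)).1 h1 b (Finset.mem_univ b)
    have hab' : 0 < G.weight a b := hab
    have h3 := (mul_eq_zero.1 h2).resolve_left hab'.ne'
    exact sub_eq_zero.1 (mul_self_eq_zero.1 h3)
  obtain ⟨p⟩ := hG.preconnected i j
  induction p with
  | nil => rfl
  | cons h _ ih => exact (hadj _ _ h).trans ih

/-- On a connected graph, every vector of sum zero is a disagreement. -/
theorem exists_disagreement_eq (hG : G.toSimpleGraph.Connected) {b : Fin N → ℝ}
    (hb : ∑ i, b i = 0) : ∃ z : Fin N → ℝ, ∀ i, G.disagreement z i = b i := by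
  let T : EuclideanSpace ℝ (Fin N) →ₗ[ℝ] EuclideanSpace ℝ (Fin N) :=
    { toFun := fun v => WithLp.toLp 2 fun i => G.disagreement v i
      map_add' := fun v w => by
        ext i
        simp only [disagreement, PiLp.add_apply, ← Finset.sum_add_distrib]
        exact Finset.sum_congr rfl fun j _ => by ring
      map_smul' := fun c v => by
        ext i
        simp only [disagreement, PiLp.smul_apply, smul_eq_mul, RingHom.id_apply, Finset.mul_sum]
        exact Finset.sum_congr rfl fun j _ => by ring }
  have hT : T.IsSymmetric := fun v w => by
    have := G.sum_mul_disagreement_comm w v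
    simp only [PiLp.inner_apply, RCLike.inner_apply, conj_trivial]
    change ∑ i, w i * G.disagreement v i = ∑ i, G.disagreement w i * v i
    rw [this]
    exact Finset.sum_congr rfl fun i _ => mul_comm _ _
  -- The range of a symmetric operator is the orthogonal complement of its kernel; here the kernel
  -- consists of constants, to which `b` is orthogonal.
  have hmem : WithLp.toLp 2 b ∈ LinearMap.range T := by
    rw [← Submodule.orthogonal_orthogonal (LinearMap.range T), hT.orthogonal_range,
      Submodule.mem_orthogonal]
    intro u hu
    have hu0 : ∀ i, G.disagreement u i = 0 := fun i => by
      have := congrArg (fun x : EuclideanSpace ℝ (Fin N) => x i) (LinearMap.mem_ker.1 hu)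
      simpa [T] using this
    obtain ⟨i₀⟩ := hG.nonempty
    simp only [PiLp.inner_apply, RCLike.inner_apply, conj_trivial]
    calc ∑ i, b i * u i = ∑ i, b i * u i₀ :=
          Finset.sum_congr rfl fun i _ => by rw [G.eq_of_disagreement_eq_zero hG hu0 i i₀]
      _ = 0 := by rw [← Finset.sum_mul, hb, zero_mul]
  obtain ⟨z, hz⟩ := hmem
  refine ⟨z, fun i => ?_⟩
  exact congrArg (fun x : EuclideanSpace ℝ (Fin N) => x i) hz

end WeightedGraph

/-! ### The optimal allocation -/

/-- With equal quadratic costs, the optimal allocation is the average of the demands. -/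
theorem IsOptimalAllocation.eq_average {N : ℕ} {d y : Fin N → ℝ}
    (h : IsOptimalAllocation (fun _ s => s ^ 2 / 2) d y) (i : Fin N) :
    y i = (1 / (N : ℝ)) * ∑ j, d j := by
  have hN : (N : ℝ) ≠ 0 := Nat.cast_ne_zero.2 (Fin.pos i).ne'
  set m := (1 / (N : ℝ)) * ∑ j, d j with hm
  have hNm : N * m = ∑ j, d j := by rw [hm]; field_simp
  have h1 := h.2 (fun _ => m) (by simp [hNm])
  -- Under the constraint `∑ y = N m`, the right side is twice the excess cost of `y` over the
  -- constant allocation `m`.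
  have h2 : ∑ i, (y i - m) ^ 2 =
      2 * ∑ i, y i ^ 2 / 2 - 2 * m * ∑ i, y i + 2 * ∑ _i : Fin N, m ^ 2 / 2 := by
    simp only [Finset.mul_sum, ← Finset.sum_sub_distrib, ← Finset.sum_add_distrib]
    exact Finset.sum_congr rfl fun i _ => by ring
  have h3 : ∑ i, (y i - m) ^ 2 ≤ 0 := by
    simp only [Finset.sum_const, Finset.card_univ, Fintype.card_fin, nsmul_eq_mul] at h1 h2
    rw [h2, h.1, ← hNm]
    nlinarith
  have h4 := (Finset.sum_eq_zero_iff_of_nonneg fun i _ => sq_nonneg (y i - m)).1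
    (h3.antisymm (Finset.sum_nonneg fun i _ => sq_nonneg _)) i (Finset.mem_univ i)
  exact sub_eq_zero.1 (pow_eq_zero_iff two_ne_zero |>.1 h4)

/-! ### Exosystem and observer error -/

/-- The exosystem state that generates the observation. -/
noncomputable def exoState {k : ℕ} (d₀ : ℝ) (freq amp phase : Fin k → ℝ) (t : ℝ) :
    ObsIndex k → ℝ :=
  Sum.elim (fun _ => d₀) fun p =>
    if p.1 = 0 then amp p.2 * Real.sin (freq p.2 * t + phase p.2)
    else amp p.2 * Real.cos (freq p.2 * t + phase p.2)

/-- An exact copy of the exosystem state would therefore remove the whole disturbance from the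
observation; the residual in the `lam` dynamics is `distRow` applied to the observer error. -/
theorem distRow_dotProduct_exoState {k : ℕ} (d₀ : ℝ) (freq amp phase : Fin k → ℝ) (t : ℝ) :
    distRow k ⬝ᵥ exoState d₀ freq amp phase t = observation d₀ freq amp phase t - d₀ := by
  simp [dotProduct, distRow, exoState, observation, Fintype.sum_prod_type]

theorem obsRow_dotProduct_exoState {k : ℕ} (d₀ : ℝ) (freq amp phase : Fin k → ℝ) (t : ℝ) :
    obsRow k ⬝ᵥ exoState d₀ freq amp phase t = observation d₀ freq amp phase t := by
  simp [dotProduct, obsRow, exoState, observation, Fintype.sum_prod_type]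

theorem hasDerivAt_exoState {k : ℕ} (d₀ : ℝ) (freq amp phase : Fin k → ℝ) (t : ℝ) :
    HasDerivAt (exoState d₀ freq amp phase) (exoMatrix freq *ᵥ exoState d₀ freq amp phase t) t := by
  have harg : ∀ j, HasDerivAt (fun t => freq j * t + phase j) (freq j) t := fun j => by
    simpa using ((hasDerivAt_id t).const_mul (freq j)).add_const (phase j)
  rw [hasDerivAt_pi]
  rintro (_ | ⟨a, j⟩)
  · refine (hasDerivAt_const t d₀).congr_deriv ?_
    simp [exoMatrix, Matrix.mulVec, dotProduct]
  · fin_cases a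
    · refine ((harg j).sin.const_mul (amp j)).congr_deriv ?_
      simp [exoMatrix, Matrix.mulVec, dotProduct, Matrix.blockDiagonal_apply, exoState,
        Fintype.sum_prod_type]
      ring
    · refine ((harg j).cos.const_mul (amp j)).congr_deriv ?_
      simp [exoMatrix, Matrix.mulVec, dotProduct, Matrix.blockDiagonal_apply, exoState,
        Fintype.sum_prod_type]
      ring

/-- The storage does not see the observer states; they are bounded as decaying error plus this
bounded exosystem state. -/
theorem abs_exoState_le {k : ℕ} (d₀ : ℝ) (freq amp phase : Fin k → ℝ) (t : ℝ) (p : ObsIndex k) :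
    |exoState d₀ freq amp phase t p| ≤ |d₀| + ∑ j, |amp j| := by
  have hle : ∀ j, |amp j| ≤ ∑ j, |amp j| := fun j =>
    Finset.single_le_sum (f := fun j => |amp j|) (fun _ _ => abs_nonneg _) (Finset.mem_univ j)
  rcases p with _ | ⟨a, j⟩
  · exact le_add_of_nonneg_right (Finset.sum_nonneg fun _ _ => abs_nonneg _)
  · refine le_trans ?_ ((hle j).trans (le_add_of_nonneg_left (abs_nonneg _)))
    simp only [exoState, Sum.elim_inr]
    split_ifs
    · rw [abs_mul]
      exact mul_le_of_le_one_right (abs_nonneg _) (Real.abs_sin_le_one _)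
    · rw [abs_mul]
      exact mul_le_of_le_one_right (abs_nonneg _) (Real.abs_cos_le_one _)

theorem abs_observation_le {k : ℕ} (d₀ : ℝ) (freq amp phase : Fin k → ℝ) (t : ℝ) :
    |observation d₀ freq amp phase t| ≤ |d₀| + ∑ j, |amp j| := by
  refine (abs_add_le _ _).trans (add_le_add_right ?_ _)
  refine (Finset.abs_sum_le_sum_abs _ _).trans (Finset.sum_le_sum fun j _ => ?_)
  rw [abs_mul]
  exact mul_le_of_le_one_right (abs_nonneg _) (Real.abs_sin_le_one _)

theorem continuous_observation {k : ℕ} (d₀ : ℝ) (freq amp phase : Fin k → ℝ) :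
    Continuous (observation d₀ freq amp phase) := by
  unfold observation
  fun_prop

/-- The observer error has the autonomous dynamics `e' = (S - L D) e`. -/
theorem hasDerivWithinAt_observer_error {k : ℕ} {d₀ : ℝ} {freq amp phase : Fin k → ℝ}
    {L : ObsIndex k → ℝ} {η : ℝ → ObsIndex k → ℝ} {I : Set ℝ} {t : ℝ}
    (h : HasDerivWithinAt η (observerMatrix freq L *ᵥ η t +
      observation d₀ freq amp phase t • L) I t) :
    HasDerivWithinAt (fun s => η s - exoState d₀ freq amp phase s)
      (observerMatrix freq L *ᵥ (η t - exoState d₀ freq amp phase t)) I t := by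
  refine (h.sub (hasDerivAt_exoState d₀ freq amp phase t).hasDerivWithinAt).congr_deriv ?_
  rw [Matrix.mulVec_sub, observerMatrix, Matrix.sub_mulVec _ _ (exoState d₀ freq amp phase t),
    Matrix.vecMulVec_mulVec, obsRow_dotProduct_exoState]
  ext p
  simp
  ring

theorem WeightedGraph.contDiff_disagreement {N : ℕ} (G : WeightedGraph N) {E : Type*}
    [NormedAddCommGroup E] [NormedSpace ℝ E] {m : WithTop ℕ∞} {f : E → Fin N → ℝ}
    (hf : ContDiff ℝ m f) (i : Fin N) : ContDiff ℝ m fun x => G.disagreement (f x) i :=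
  ContDiff.sum fun j _ => contDiff_const.mul ((contDiff_pi.1 hf i).sub (contDiff_pi.1 hf j))

/-! ### The closed-loop field and its storage -/

section ClosedLoop

variable {N : ℕ} (G : WeightedGraph N) {n k : Fin N → ℕ} (P : ∀ i, Agent (n i))
  (U : Fin N → ℝ → ℝ) (freq : ∀ i, Fin (k i) → ℝ) (L : ∀ i, ObsIndex (k i) → ℝ) (γ : ℝ)

/-- The way in which the observations enter the closed loop. -/
def observationInput (L : ∀ i, ObsIndex (k i) → ℝ) (d : Fin N → ℝ) : LoopState n k :=
  (0, d, fun i => d i • L i, 0)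

/-- Time enters only through the additive observations, so the field is an autonomous smooth part
plus a bounded input, the form needed for global existence. -/
theorem loopField_eq_add (d : Fin N → ℝ → ℝ) :
    loopField G P U freq L γ d = fun t w =>
      loopField G P U freq L γ (fun _ _ => 0) 0 w + observationInput L fun i => d i t := by
  funext t ⟨x, lam, η, z⟩
  simp only [loopField, observationInput, Prod.mk_add_mk, Prod.mk.injEq]
  refine ⟨by simp, ?_, ?_, by simp⟩
  · funext i
    simp only [Pi.add_apply]
    ring
  · funext i
    simp

theorem contDiff_loopField {m : WithTop ℕ∞} (hm : m ≤ ∞) (hU : ∀ i, ContDiff ℝ ∞ (U i))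
    (d : Fin N → ℝ → ℝ) (t : ℝ) : ContDiff ℝ m (loopField G P U freq L γ d t) := by
  have hg : ∀ i, ContDiff ℝ m (Function.uncurry (P i).g) := fun i => (P i).g_smooth.of_le hm
  have hh : ∀ i, ContDiff ℝ m (P i).h := fun i => (P i).h_smooth.of_le hm
  have hU' : ∀ i, ContDiff ℝ m (U i) := fun i => (hU i).of_le hm
  have hx : ∀ i, ContDiff ℝ m fun w : LoopState n k => w.1 i := fun i =>
    contDiff_pi.1 contDiff_fst i
  have hη : ∀ i p, ContDiff ℝ m fun w : LoopState n k => w.2.2.1 i p := fun i p =>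
    contDiff_pi.1 (contDiff_pi.1 (contDiff_fst.comp (contDiff_snd.comp contDiff_snd)) i) p
  have hlam : ContDiff ℝ m fun w : LoopState n k => w.2.1 := contDiff_fst.comp contDiff_snd
  have hz : ContDiff ℝ m fun w : LoopState n k => w.2.2.2 :=
    contDiff_snd.comp (contDiff_snd.comp contDiff_snd)
  have hy : ∀ i, ContDiff ℝ m fun w : LoopState n k => (P i).h (w.1 i) :=
    fun i => (hh i).comp (hx i)
  refine ContDiff.prodMk (f := fun w => (loopField G P U freq L γ d t w).1) ?_
    (ContDiff.prodMk (f := fun w => (loopField G P U freq L γ d t w).2.1) ?_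
    (ContDiff.prodMk (f := fun w => (loopField G P U freq L γ d t w).2.2.1)
      (g := fun w => (loopField G P U freq L γ d t w).2.2.2) ?_ ?_))
  · refine contDiff_pi.2 fun i => (hg i).comp ((hx i).prodMk ?_)
    exact ((contDiff_const.mul (hy i)).add (contDiff_pi.1 hlam i)).add ((hU' i).comp (hy i))
  · refine contDiff_pi.2 fun i => ?_
    exact ((((G.contDiff_disagreement hlam i).neg.sub (G.contDiff_disagreement hz i)).add
      contDiff_const).sub (hy i)).sub (ContDiff.sum fun p _ => contDiff_const.mul (hη i p))
  · refine contDiff_pi.2 fun i => contDiff_pi.2 fun p => ?_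
    have h : ContDiff ℝ m fun w : LoopState n k =>
        ∑ q, observerMatrix (freq i) (L i) p q * w.2.2.1 i q + d i t * L i p :=
      (ContDiff.sum fun q _ => contDiff_const.mul (hη i q)).add contDiff_const
    exact h
  · exact contDiff_pi.2 fun i => G.contDiff_disagreement hlam i

/-- The total storage of the closed loop. -/
noncomputable def loopStorage (V : ∀ i, EuclideanSpace ℝ (Fin (n i)) → ℝ) (lams zs : Fin N → ℝ)
    (w : LoopState n k) : ℝ :=
  ∑ i, (V i (w.1 i) + (w.2.1 i - lams i) ^ 2 / 2 + (w.2.2.2 i - zs i) ^ 2 / 2 + 1 / 2)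

variable {V : ∀ i, EuclideanSpace ℝ (Fin (n i)) → ℝ} {lams zs : Fin N → ℝ}

theorem loopStorage_nonneg (hV : ∀ i x, 0 ≤ V i x) (w : LoopState n k) :
    0 ≤ loopStorage V lams zs w :=
  Finset.sum_nonneg fun i _ => by
    have := hV i (w.1 i)
    positivity

/-- Sublevel sets of the storage are bounded in all components but the observer states. -/
theorem exists_bound_of_loopStorage_le {xs : ∀ i, EuclideanSpace ℝ (Fin (n i))}
    {α : Fin N → ℝ → ℝ} (hα : ∀ i, Tendsto (α i) atTop atTop)
    (hV : ∀ i x, 0 ≤ V i x) (hαV : ∀ i x, α i ‖x - xs i‖ ≤ V i x) (W : ℝ) :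
    ∃ R, ∀ w : LoopState n k, loopStorage V lams zs w ≤ W →
      ∀ i, ‖w.1 i‖ ≤ R ∧ |w.2.1 i| ≤ R ∧ |w.2.2.2 i| ≤ R := by
  have hr : ∀ i, ∃ r, ∀ s ≥ r, W < α i s := fun i =>
    (eventually_atTop.1 ((hα i).eventually_gt_atTop W))
  choose r hr using hr
  refine ⟨∑ i, (|r i| + ‖xs i‖ + |lams i| + |zs i|) + (2 * |W| + 1), fun w hw i => ?_⟩
  have hterm : V i (w.1 i) + (w.2.1 i - lams i) ^ 2 / 2 + (w.2.2.2 i - zs i) ^ 2 / 2 + 1 / 2 ≤ W :=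
    le_trans (Finset.single_le_sum (f := fun i =>
      V i (w.1 i) + (w.2.1 i - lams i) ^ 2 / 2 + (w.2.2.2 i - zs i) ^ 2 / 2 + 1 / 2)
      (fun j _ => by have := hV j (w.1 j); positivity) (Finset.mem_univ i)) hw
  have hsum : |r i| + ‖xs i‖ + |lams i| + |zs i| ≤
      ∑ i, (|r i| + ‖xs i‖ + |lams i| + |zs i|) :=
    Finset.single_le_sum (f := fun i => |r i| + ‖xs i‖ + |lams i| + |zs i|)
      (fun j _ => by positivity) (Finset.mem_univ i)
  have hW := le_abs_self W
  have hVi := hV i (w.1 i)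
  have h1 := sq_nonneg (w.2.1 i - lams i)
  have h2 := sq_nonneg (w.2.2.2 i - zs i)
  have := abs_nonneg (r i)
  have := norm_nonneg (xs i)
  have := abs_nonneg (lams i)
  have := abs_nonneg (zs i)
  -- The bound `2 * |W| + 1` avoids a square root, since `2 * |W| ≤ (2 * |W| + 1) ^ 2`.
  have hsq : ∀ a s : ℝ, (a - s) ^ 2 ≤ 2 * |W| → |a| ≤ |s| + (2 * |W| + 1) := fun a s has => by
    have h3 : |a - s| ≤ 2 * |W| + 1 := abs_le_of_sq_le_sq (by nlinarith [abs_nonneg W])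
      (by positivity)
    have := abs_sub_abs_le_abs_sub a s
    linarith
  refine ⟨?_, ?_, ?_⟩
  · have h3 : ‖w.1 i - xs i‖ ≤ r i := by
      by_contra! h
      have h4 := hr i _ h.le
      have h5 := hαV i (w.1 i)
      linarith
    have h4 := norm_sub_norm_le (w.1 i) (xs i)
    have := le_abs_self (r i)
    have := abs_nonneg W
    linarith
  · have := hsq _ _ (show (w.2.1 i - lams i) ^ 2 ≤ 2 * |W| by linarith)
    linarith
  · have := hsq _ _ (show (w.2.2.2 i - zs i) ^ 2 ≤ 2 * |W| by linarith)
    linarith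

/-- The derivative of the storage along a state velocity `v` at the state `w`. -/
noncomputable def loopStorageDeriv (V : ∀ i, EuclideanSpace ℝ (Fin (n i)) → ℝ)
    (lams zs : Fin N → ℝ) (w v : LoopState n k) : ℝ :=
  ∑ i, (fderiv ℝ (V i) (w.1 i) (v.1 i) + (w.2.1 i - lams i) * v.2.1 i
    + (w.2.2.2 i - zs i) * v.2.2.2 i)

theorem hasDerivWithinAt_loopStorage (hV : ∀ i, Differentiable ℝ (V i)) {w : ℝ → LoopState n k}
    {v : LoopState n k} {I : Set ℝ} {t : ℝ} (hw : HasDerivWithinAt w v I t) :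
    HasDerivWithinAt (fun s => loopStorage V lams zs (w s)) (loopStorageDeriv V lams zs (w t) v)
      I t := by
  have hsnd := (hasFDerivAt_snd (𝕜 := ℝ) (p := w t)).comp_hasDerivWithinAt t hw
  have hsnd2 := (hasFDerivAt_snd (𝕜 := ℝ) (p := (w t).2)).comp_hasDerivWithinAt t hsnd
  have hx := fun i => hasDerivWithinAt_pi.1
    ((hasFDerivAt_fst (𝕜 := ℝ) (p := w t)).comp_hasDerivWithinAt t hw) i
  have hl := fun i => hasDerivWithinAt_pi.1
    ((hasFDerivAt_fst (𝕜 := ℝ) (p := (w t).2)).comp_hasDerivWithinAt t hsnd) i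
  have hz := fun i => hasDerivWithinAt_pi.1
    ((hasFDerivAt_snd (𝕜 := ℝ) (p := (w t).2.2)).comp_hasDerivWithinAt t hsnd2) i
  have hsq : ∀ {f : ℝ → ℝ} {f' : ℝ} (c : ℝ), HasDerivWithinAt f f' I t →
      HasDerivWithinAt (fun s => (f s - c) ^ 2 / 2) ((f t - c) * f') I t := fun c hf => by
    refine (((hf.sub_const c).pow 2).div_const 2).congr_deriv ?_
    simp
    ring
  refine HasDerivWithinAt.fun_sum fun i _ => ?_
  exact ((((hV i (w t |>.1 i)).hasFDerivAt.comp_hasDerivWithinAt t (hx i)).add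
    (hsq (lams i) (hl i))).add (hsq (zs i) (hz i))).add_const (1 / 2)

end ClosedLoop

/-! ### Dissipation inequality and observer accuracy -/

section ClosedLoopEstimates

variable {N : ℕ} {G : WeightedGraph N} {n k : Fin N → ℕ} {P : ∀ i, Agent (n i)}
  {U : Fin N → ℝ → ℝ} {freq : ∀ i, Fin (k i) → ℝ} {L : ∀ i, ObsIndex (k i) → ℝ} {γ : ℝ}
  {V : ∀ i, EuclideanSpace ℝ (Fin (n i)) → ℝ} {lams zs : Fin N → ℝ}

/-- Along the closed loop the storage satisfies `W' ≤ -∑ (y - y*)² + ε W` when the disturbance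
estimates are `ε`-accurate. -/
theorem loopStorageDeriv_le {ys d₀ : Fin N → ℝ} {C : Fin N → Set ℝ} {M : Fin N → ℝ≥0}
    {d : Fin N → ℝ → ℝ} {t ε : ℝ}
    (hM : ∀ i, LipschitzOnWith (M i) (U i) (C i)) (hγ : ∀ i, 1 + (M i : ℝ) < γ)
    (hC : ∀ i, ys i ∈ C i)
    (hV : ∀ i x, 0 ≤ V i x)
    (hpass : ∀ i x u, fderiv ℝ (V i) x ((P i).g x u) ≤ ((P i).h x - ys i) * (u - U i (ys i)))
    (hlams : ∀ i, lams i = γ * ys i) (hlams0 : ∀ i, G.disagreement lams i = 0)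
    (hzs : ∀ i, G.disagreement zs i = d₀ i - ys i) {w : LoopState n k}
    (hw : ∀ i, (P i).h (w.1 i) ∈ C i)
    (hε : ∀ i, |d i t - d₀ i - distRow (k i) ⬝ᵥ w.2.2.1 i| ≤ ε) :
    loopStorageDeriv V lams zs w (loopField G P U freq L γ d t w) ≤
      -∑ i, ((P i).h (w.1 i) - ys i) ^ 2 + ε * loopStorage V lams zs w := by
  obtain ⟨x, lam, η, z⟩ := w
  simp only at hw hε
  set lt : Fin N → ℝ := fun i => lam i - lams i with hlt
  set zt : Fin N → ℝ := fun i => z i - zs i with hzt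
  have hdl : ∀ i, G.disagreement lam i = G.disagreement lt i := fun i => by
    rw [hlt, G.disagreement_sub, hlams0, sub_zero]
  have hdz : ∀ i, G.disagreement z i = G.disagreement zt i + (d₀ i - ys i) := fun i => by
    rw [hzt, G.disagreement_sub, hzs, sub_add_cancel]
  have hterm : ∀ i, fderiv ℝ (V i) (x i)
        ((P i).g (x i) (-γ * (P i).h (x i) + lam i + U i ((P i).h (x i))))
      + (lam i - lams i) * (-G.disagreement lam i - G.disagreement z i + d i t - (P i).h (x i)
        - distRow (k i) ⬝ᵥ η i) + (z i - zs i) * G.disagreement lam i ≤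
      -((P i).h (x i) - ys i) ^ 2
      + ε * (V i (x i) + (lam i - lams i) ^ 2 / 2 + (z i - zs i) ^ 2 / 2 + 1 / 2)
      - lt i * G.disagreement lt i - lt i * G.disagreement zt i + zt i * G.disagreement lt i := by
    intro i
    have h1 := hpass i (x i) (-γ * (P i).h (x i) + lam i + U i ((P i).h (x i)))
    set y := (P i).h (x i) with hy
    set δ := d i t - d₀ i - distRow (k i) ⬝ᵥ η i with hδ
    have hε0 : 0 ≤ ε := (abs_nonneg _).trans (hε i)
    have h2 : (y - ys i) * (U i y - U i (ys i)) ≤ M i * (y - ys i) ^ 2 := by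
      have h3 := (hM i).dist_le_mul _ (hw i) _ (hC i)
      rw [Real.dist_eq, Real.dist_eq] at h3
      calc _ ≤ |(y - ys i) * (U i y - U i (ys i))| := le_abs_self _
        _ = |y - ys i| * |U i y - U i (ys i)| := abs_mul _ _
        _ ≤ |y - ys i| * (M i * |y - ys i|) := by gcongr
        _ = M i * |y - ys i| ^ 2 := by ring
        _ = _ := by rw [sq_abs]
    have h3 : (1 + (M i : ℝ)) * (y - ys i) ^ 2 ≤ γ * (y - ys i) ^ 2 :=
      mul_le_mul_of_nonneg_right (hγ i).le (sq_nonneg _)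
    -- The error enters linearly in `lt i`; the constant `1 / 2` in the storage lets `ε` times the
    -- storage dominate it.
    have h4 : lt i * δ ≤ ε * (lt i ^ 2 / 2 + 1 / 2) := by
      calc lt i * δ ≤ |lt i * δ| := le_abs_self _
        _ = |lt i| * |δ| := abs_mul _ _
        _ ≤ |lt i| * ε := by gcongr; exact hε i
        _ ≤ (lt i ^ 2 / 2 + 1 / 2) * ε := by
            gcongr
            rw [← sq_abs (lt i)]
            nlinarith [sq_nonneg (|lt i| - 1)]
        _ = _ := mul_comm _ _
    have h5 : 0 ≤ ε * (V i (x i) + zt i ^ 2 / 2) := by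
      have := hV i (x i)
      positivity
    have h6 : distRow (k i) ⬝ᵥ η i = d i t - d₀ i - δ := by rw [hδ]; ring
    have h7 : lam i = lt i + γ * ys i := by rw [hlt, ← hlams]; ring
    rw [hdl, hdz, h6]
    change _ + lt i * _ + zt i * _ ≤
      _ + ε * (V i (x i) + lt i ^ 2 / 2 + zt i ^ 2 / 2 + 1 / 2) - _ - _ + _
    rw [h7] at h1 ⊢
    nlinarith
  calc loopStorageDeriv V lams zs (x, lam, η, z) (loopField G P U freq L γ d t (x, lam, η, z))
      ≤ ∑ i, (-((P i).h (x i) - ys i) ^ 2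
        + ε * (V i (x i) + (lam i - lams i) ^ 2 / 2 + (z i - zs i) ^ 2 / 2 + 1 / 2)
        - lt i * G.disagreement lt i - lt i * G.disagreement zt i
        + zt i * G.disagreement lt i) := Finset.sum_le_sum fun i _ => hterm i
    _ = -∑ i, ((P i).h (x i) - ys i) ^ 2 + ε * loopStorage V lams zs (x, lam, η, z)
        - ∑ i, lt i * G.disagreement lt i := by
      -- By symmetry the two mixed `lt`, `zt` sums cancel; only the nonnegative Laplacian form in
      -- `lt` remains.
      have h := G.sum_mul_disagreement_comm lt zt
      simp only [Finset.sum_add_distrib, Finset.sum_sub_distrib, loopStorage, Finset.mul_sum,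
        Finset.sum_neg_distrib, mul_add] at h ⊢
      linarith
    _ ≤ _ := by
      have := G.sum_mul_disagreement_nonneg lt
      linarith

/-- A nonnegative storage with `W' ≤ -q + κ exp (-b t) W` becomes a Lyapunov function after
multiplication by an integrating factor. -/
theorem exists_hasDerivWithinAt_mul_exp_le {W : ℝ → ℝ} {W' b κ q t : ℝ} {I : Set ℝ}
    (hb : 0 < b) (hκ : 0 ≤ κ) (hq : 0 ≤ q) (hW : HasDerivWithinAt W W' I t)
    (hW' : W' ≤ -q + κ * Real.exp (-b * t) * W t) :
    ∃ D, HasDerivWithinAt (fun s => W s * Real.exp (κ / b * Real.exp (-b * s))) D I t ∧ D ≤ -q := by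
  have h1 : HasDerivAt (fun s : ℝ => κ / b * Real.exp (-b * s)) (-κ * Real.exp (-b * t)) t := by
    have h2 : HasDerivAt (fun s : ℝ => -b * s) (-b * 1) t := (hasDerivAt_id t).const_mul (-b)
    refine (h2.exp.const_mul (κ / b)).congr_deriv ?_
    field_simp
  refine ⟨_, hW.mul h1.exp.hasDerivWithinAt, ?_⟩
  -- The weight decreases at exactly the rate that cancels the perturbation. Being at least `1`, it
  -- preserves the decrease `-q`.
  set E := Real.exp (κ / b * Real.exp (-b * t)) with hE
  have hE1 : 1 ≤ E := Real.one_le_exp (by positivity)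
  calc W' * E + W t * (E * (-κ * Real.exp (-b * t)))
      = (W' - κ * Real.exp (-b * t) * W t) * E := by ring
    _ ≤ -q * E := mul_le_mul_of_nonneg_right (by linarith) (by linarith)
    _ ≤ -q := by nlinarith

/-- The observers estimate their exosystem states with exponential accuracy. -/
theorem exists_observer_decay (hL : ∀ i, IsHurwitz (observerMatrix (freq i) (L i)))
    (d₀ : Fin N → ℝ) (amp phase : ∀ i, Fin (k i) → ℝ) (w₀ : LoopState n k) :
    ∃ b K : ℝ, 0 < b ∧ 0 ≤ K ∧ ∀ (T : ℝ) (w : ℝ → LoopState n k), w 0 = w₀ →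
      SolvesOn (loopField G P U freq L γ fun i => observation (d₀ i) (freq i) (amp i) (phase i))
        (Icc 0 T) w →
      ∀ t ∈ Icc 0 T, ∀ i,
        ‖(w t).2.2.1 i - exoState (d₀ i) (freq i) (amp i) (phase i) t‖ ≤ K * Real.exp (-b * t) := by
  choose b K hb hK h using fun i => (hL i).exists_decay
  have hbmin : ∃ b₀ : ℝ, 0 < b₀ ∧ ∀ i, b₀ ≤ b i := by
    rcases isEmpty_or_nonempty (Fin N) with hN | hN
    · exact ⟨1, one_pos, fun i => isEmptyElim i⟩
    · obtain ⟨i₀, hi₀⟩ := Finite.exists_min b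
      exact ⟨b i₀, hb i₀, hi₀⟩
  obtain ⟨b₀, hb₀, hle⟩ := hbmin
  set e₀ : Fin N → ℝ := fun i =>
    K i * ‖w₀.2.2.1 i - exoState (d₀ i) (freq i) (amp i) (phase i) 0‖ with he₀
  have he₀0 : ∀ i, 0 ≤ e₀ i := fun i => mul_nonneg (hK i) (norm_nonneg _)
  refine ⟨b₀, ∑ i, e₀ i, hb₀, Finset.sum_nonneg fun i _ => he₀0 i, fun T w hw0 hw t ht i => ?_⟩
  have h1 := h i T (fun s => (w s).2.2.1 i - exoState (d₀ i) (freq i) (amp i) (phase i) s)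
    (fun s hs => by
      have hsnd := (hasFDerivAt_snd (𝕜 := ℝ) (p := w s)).comp_hasDerivWithinAt s (hw s hs)
      have hsnd2 := (hasFDerivAt_snd (𝕜 := ℝ) (p := (w s).2)).comp_hasDerivWithinAt s hsnd
      have hη := hasDerivWithinAt_pi.1
        ((hasFDerivAt_fst (𝕜 := ℝ) (p := (w s).2.2)).comp_hasDerivWithinAt s hsnd2) i
      exact hasDerivWithinAt_observer_error hη) t ht
  rw [hw0] at h1
  refine h1.trans ?_
  have h2 : e₀ i ≤ ∑ i, e₀ i :=
    Finset.single_le_sum (fun i _ => he₀0 i) (Finset.mem_univ i)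
  have h3 := hle i
  have h4 := ht.1
  have h5 := (he₀0 i).trans h2
  change e₀ i * _ ≤ _
  gcongr

theorem abs_distRow_dotProduct_le {m : ℕ} (v : ObsIndex m → ℝ) :
    |distRow m ⬝ᵥ v| ≤ Fintype.card (ObsIndex m) * ‖v‖ := by
  rw [← nsmul_eq_mul, ← Finset.card_univ]
  refine (Finset.abs_sum_le_sum_abs _ _).trans (Finset.sum_le_card_nsmul _ _ _ fun p _ => ?_)
  rw [abs_mul]
  have h1 : |distRow m p| ≤ 1 := by
    rcases p with _ | p
    · simp [distRow]
    · simp only [distRow, Sum.elim_inr]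
      split_ifs <;> simp
  calc |distRow m p| * |v p| ≤ 1 * ‖v‖ := by
        gcongr
        exact norm_le_pi_norm v p
    _ = ‖v‖ := one_mul _

end ClosedLoopEstimates

theorem norm_observationInput_le {N : ℕ} {n k : Fin N → ℕ} (L : ∀ i, ObsIndex (k i) → ℝ)
    {d : Fin N → ℝ} {β : ℝ} (hβ : ∀ i, |d i| ≤ β) (hβ0 : 0 ≤ β) :
    ‖(observationInput L d : LoopState n k)‖ ≤ β * (1 + ‖L‖) := by
  have h1 : β ≤ β * (1 + ‖L‖) := le_mul_of_one_le_right hβ0 (by simp)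
  have h0 : 0 ≤ β * (1 + ‖L‖) := hβ0.trans h1
  refine norm_prod_le_iff.2 ⟨?_, norm_prod_le_iff.2 ⟨?_, norm_prod_le_iff.2 ⟨?_, ?_⟩⟩⟩
  · simpa [observationInput] using h0
  · exact (pi_norm_le_iff_of_nonneg h0).2 fun i => (hβ i).trans h1
  · refine (pi_norm_le_iff_of_nonneg h0).2 fun i => ?_
    change ‖d i • L i‖ ≤ _
    rw [norm_smul]
    have h2 : ‖L i‖ ≤ 1 + ‖L‖ := (norm_le_pi_norm L i).trans (by simp)
    have h3 : ‖d i‖ ≤ β := hβ i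
    gcongr
  · simpa [observationInput] using h0

theorem continuous_observationInput {N : ℕ} {n k : Fin N → ℕ} (L : ∀ i, ObsIndex (k i) → ℝ)
    {d : Fin N → ℝ → ℝ} (hd : ∀ i, Continuous (d i)) :
    Continuous fun t => (observationInput L fun i => d i t : LoopState n k) := by
  unfold observationInput
  fun_prop

/-! ### Boundedness, global existence and convergence -/

theorem corollary2 {N : ℕ}
    -- the communication graph
    (G : WeightedGraph N) (hG : G.toSimpleGraph.Connected)
    -- the agents and their private data
    (n : Fin N → ℕ) (P : ∀ i, Agent (n i)) (d₀ : Fin N → ℝ)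
    -- the optimal solution of the allocation problem with costs `s ^ 2 / 2`
    (ys : Fin N → ℝ) (hys : IsOptimalAllocation (fun _ s => s ^ 2 / 2) d₀ ys)
    -- the regulator equations; `C i` is the set of outputs on which `U i` is Lipschitz
    (X : ∀ i, ℝ → EuclideanSpace ℝ (Fin (n i))) (U : Fin N → ℝ → ℝ)
    (hreg : ∀ i, (P i).IsRegulator (X i) (U i))
    (C : Fin N → Set ℝ) (hC : ∀ i, ys i ∈ C i)
    (M : Fin N → ℝ≥0) (hM : ∀ i, LipschitzOnWith (M i) (U i) (C i))
    -- passivity at the optimal steady state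
    (hpass : ∀ i, (P i).PassiveAt (X i (ys i)) (U i (ys i)))
    -- the sinusoidal disturbances
    (k : Fin N → ℕ) (freq amp phase : ∀ i, Fin (k i) → ℝ)
    (h_freq : ∀ i j, 0 < freq i j) (h_freq_inj : ∀ i, Function.Injective (freq i))
    -- the gains
    (L : ∀ i, ObsIndex (k i) → ℝ) (hL : ∀ i, IsHurwitz (observerMatrix (freq i) (L i)))
    (γ : ℝ) (hγ : ∀ i, 1 + (M i : ℝ) < γ)
    -- an initial state whose closed-loop solutions, as long as they exist, have their outputs
    -- in the sets `C i` (no restriction if `C i = univ`)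
    (w₀ : LoopState n k)
    (hw₀ : ∀ (T : ℝ) (w : ℝ → LoopState n k), w 0 = w₀ →
      SolvesOn (loopField G P U freq L γ fun i => observation (d₀ i) (freq i) (amp i) (phase i))
        (Icc 0 T) w →
      ∀ t ∈ Icc 0 T, ∀ i, (P i).h ((w t).1 i) ∈ C i) :
    -- the closed loop has a solution for all future time, and every such solution has bounded
    -- agent trajectories and outputs that converge to the average
    (∃ w : ℝ → LoopState n k, w 0 = w₀ ∧
      SolvesOn (loopField G P U freq L γ fun i => observation (d₀ i) (freq i) (amp i) (phase i))
        (Ici 0) w) ∧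
    ∀ w : ℝ → LoopState n k, w 0 = w₀ →
      SolvesOn (loopField G P U freq L γ fun i => observation (d₀ i) (freq i) (amp i) (phase i))
        (Ici 0) w →
      (∀ i, ∃ B : ℝ, ∀ t, 0 ≤ t → ‖(w t).1 i‖ ≤ B) ∧
      (∀ i, Tendsto (fun t => (P i).h ((w t).1 i)) atTop (𝓝 ((1 / (N : ℝ)) * ∑ j, d₀ j))) ∧
      -- in particular, output average consensus
      ((∀ j, d₀ j = (P j).h (w₀.1 j)) →
        ∀ i, Tendsto (fun t => (P i).h ((w t).1 i)) atTop
          (𝓝 ((1 / (N : ℝ)) * ∑ j, (P j).h (w₀.1 j)))) := by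
  set d : Fin N → ℝ → ℝ := fun i => observation (d₀ i) (freq i) (amp i) (phase i) with hd
  have hout : ∀ i, (P i).h (X i (ys i)) = ys i := fun i => (hreg i).1.output _
  have havg : ∀ i, ys i = (1 / (N : ℝ)) * ∑ j, d₀ j := hys.eq_average
  choose V α₁ α₂ hVc hα₁ hα₂ hVα hVp using hpass
  have hV0 : ∀ i x, 0 ≤ V i x := fun i x => by
    refine le_trans ?_ (hVα i x).1
    rw [← (hα₁ i).map_zero]
    exact (hα₁ i).strictMonoOn.monotoneOn self_mem_Ici (norm_nonneg _) (norm_nonneg _)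
  -- At the equilibrium the input `-γ y* + lam* + U y*` must equal `U y*`, which forces this value.
  set lams : Fin N → ℝ := fun i => γ * ys i with hlams
  have hlams0 : ∀ i, G.disagreement lams i = 0 := fun i => by
    have : lams = fun _ => γ * ((1 / (N : ℝ)) * ∑ j, d₀ j) := by
      funext j
      exact congrArg (γ * ·) (havg j)
    rw [this, G.disagreement_const]
  obtain ⟨zs, hzs⟩ := G.exists_disagreement_eq hG (b := fun i => d₀ i - ys i)
    (by rw [Finset.sum_sub_distrib, hys.1, sub_self])
  obtain ⟨b, K, hb, hK, hobs⟩ := exists_observer_decay (G := G) (P := P) (U := U) (γ := γ) hL d₀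
    amp phase w₀
  set κ : ℝ := (∑ i, (Fintype.card (ObsIndex (k i)) : ℝ)) * K with hκ
  have hκ0 : 0 ≤ κ := mul_nonneg (Finset.sum_nonneg fun i _ => Nat.cast_nonneg _) hK
  set Ω : LoopState n k → ℝ → ℝ := fun w t =>
    loopStorage V lams zs w * Real.exp (κ / b * Real.exp (-b * t)) with hΩ
  -- The set `I` is free because the derivative is needed within `Icc 0 T` for the a priori bound
  -- and within `Ici 0` for the limit.
  have hlyap : ∀ (T : ℝ) (w : ℝ → LoopState n k), w 0 = w₀ →
      SolvesOn (loopField G P U freq L γ d) (Icc 0 T) w → ∀ t ∈ Icc 0 T, ∀ I : Set ℝ,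
      HasDerivWithinAt w (loopField G P U freq L γ d t (w t)) I t →
      ∃ D, HasDerivWithinAt (fun s => Ω (w s) s) D I t ∧
        D ≤ -∑ i, ((P i).h ((w t).1 i) - ys i) ^ 2 := by
    intro T w hw0 hw t ht I hI
    refine exists_hasDerivWithinAt_mul_exp_le (W := fun s => loopStorage V lams zs (w s)) hb hκ0
      (Finset.sum_nonneg fun i _ => sq_nonneg _)
      (hasDerivWithinAt_loopStorage (fun i => (hVc i).differentiable one_ne_zero) hI) ?_
    refine loopStorageDeriv_le hM hγ hC hV0 (fun i x u => ?_) (fun i => rfl) hlams0 hzs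
      (hw₀ T w hw0 hw t ht) fun i => ?_
    · simpa only [hout] using hVp i x u
    · have h1 := hobs T w hw0 hw t ht i
      have h2 := abs_distRow_dotProduct_le
        ((w t).2.2.1 i - exoState (d₀ i) (freq i) (amp i) (phase i) t)
      rw [dotProduct_sub, distRow_dotProduct_exoState, abs_sub_comm] at h2
      refine h2.trans ?_
      have h3 : (Fintype.card (ObsIndex (k i)) : ℝ) ≤
          ∑ i, (Fintype.card (ObsIndex (k i)) : ℝ) :=
        Finset.single_le_sum (f := fun i => (Fintype.card (ObsIndex (k i)) : ℝ))
          (fun i _ => Nat.cast_nonneg _) (Finset.mem_univ i)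
      rw [hκ, mul_assoc]
      gcongr
  have hstorage : ∀ (T : ℝ) (w : ℝ → LoopState n k), w 0 = w₀ →
      SolvesOn (loopField G P U freq L γ d) (Icc 0 T) w → ∀ t ∈ Icc 0 T,
      loopStorage V lams zs (w t) ≤ Ω w₀ 0 := by
    intro T w hw0 hw t ht
    have hder := fun s (hs : s ∈ Icc 0 T) => hlyap T w hw0 hw s hs _ (hw s hs)
    choose! D hD hD' using hder
    have hanti : AntitoneOn (fun s => Ω (w s) s) (Icc 0 T) :=
      antitoneOn_of_deriv_nonpos (convex_Icc 0 T) (fun s hs => (hD s hs).continuousWithinAt)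
        (fun s hs => ((hD s (interior_subset hs)).mono interior_subset).differentiableWithinAt)
        (fun s hs => by
          rw [((hD s (interior_subset hs)).hasDerivAt (mem_interior_iff_mem_nhds.1 hs)).deriv]
          exact (hD' s (interior_subset hs)).trans
            (neg_nonpos.2 (Finset.sum_nonneg fun i _ => sq_nonneg _)))
    have h1 : Ω (w t) t ≤ Ω (w 0) 0 := hanti ⟨le_rfl, ht.1.trans ht.2⟩ ht ht.1
    rw [hw0] at h1
    refine le_trans ?_ h1
    exact le_mul_of_one_le_right (loopStorage_nonneg hV0 _) (Real.one_le_exp (by positivity))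
  obtain ⟨R, hR⟩ := exists_bound_of_loopStorage_le (lams := lams) (zs := zs) (k := k)
    (fun i => (hα₁ i).tendsto_atTop) hV0 (fun i x => (hVα i x).1) (Ω w₀ 0)
  set β : ℝ := ∑ i, (|d₀ i| + ∑ j, |amp i j|) with hβ
  have hβi : ∀ i, |d₀ i| + ∑ j, |amp i j| ≤ β := fun i =>
    Finset.single_le_sum (f := fun i => |d₀ i| + ∑ j, |amp i j|)
      (fun i _ => by positivity) (Finset.mem_univ i)
  have hβ0 : 0 ≤ β := Finset.sum_nonneg fun i _ => by positivity
  have hbound : ∀ (T : ℝ) (w : ℝ → LoopState n k), w 0 = w₀ →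
      SolvesOn (loopField G P U freq L γ d) (Icc 0 T) w → ∀ t ∈ Icc 0 T,
      ‖w t‖ ≤ max R (K + β) := by
    intro T w hw0 hw t ht
    have h := hR (w t) (hstorage T w hw0 hw t ht)
    have h0 : 0 ≤ max R (K + β) := le_trans (by positivity) (le_max_right _ _)
    refine norm_prod_le_iff.2 ⟨?_, norm_prod_le_iff.2 ⟨?_, norm_prod_le_iff.2 ⟨?_, ?_⟩⟩⟩
    · exact (pi_norm_le_iff_of_nonneg h0).2 fun i => (h i).1.trans (le_max_left _ _)
    · exact (pi_norm_le_iff_of_nonneg h0).2 fun i => (h i).2.1.trans (le_max_left _ _)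
    · refine (pi_norm_le_iff_of_nonneg h0).2 fun i => le_trans ?_ (le_max_right _ _)
      have h1 := hobs T w hw0 hw t ht i
      have h2 : ‖exoState (d₀ i) (freq i) (amp i) (phase i) t‖ ≤ β :=
        (pi_norm_le_iff_of_nonneg hβ0).2 fun p => (abs_exoState_le _ _ _ _ t p).trans (hβi i)
      have h3 : K * Real.exp (-b * t) ≤ K :=
        mul_le_of_le_one_right hK (Real.exp_le_one_iff.2 (by nlinarith [ht.1]))
      have h4 := norm_add_le ((w t).2.2.1 i - exoState (d₀ i) (freq i) (amp i) (phase i) t)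
        (exoState (d₀ i) (freq i) (amp i) (phase i) t)
      rw [sub_add_cancel] at h4
      linarith
    · exact (pi_norm_le_iff_of_nonneg h0).2 fun i => (h i).2.2.trans (le_max_left _ _)
  have hU : ∀ i, ContDiff ℝ ∞ (U i) := fun i => (hreg i).1.smooth_input
  have hF₀ : ContDiff ℝ 1 (loopField G P U freq L γ (fun _ _ => 0) 0) :=
    contDiff_loopField G P U freq L γ (by exact_mod_cast le_top) hU _ _
  have hBn : ∀ t, ‖(observationInput L fun i => d i t : LoopState n k)‖ ≤ β * (1 + ‖L‖) :=
    fun t => norm_observationInput_le L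
      (fun i => (abs_observation_le _ _ _ _ t).trans (hβi i)) hβ0
  have hBc : Continuous fun t => (observationInput L fun i => d i t : LoopState n k) :=
    continuous_observationInput L fun i => continuous_observation _ _ _ _
  refine ⟨?_, fun w hw0 hw => ?_⟩
  · have hb' := hbound
    rw [loopField_eq_add G P U freq L γ d] at hb' ⊢
    exact exists_solvesOn_Ici_of_bounded hF₀ hBc hBn hb'
  have hsub : ∀ T, SolvesOn (loopField G P U freq L γ d) (Icc 0 T) w :=
    fun T => hw.mono Icc_subset_Ici_self
  have hwb : ∀ t, 0 ≤ t → ‖w t‖ ≤ max R (K + β) := fun t ht =>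
    hbound t w hw0 (hsub t) t ⟨ht, le_rfl⟩
  have hlim : ∀ i, Tendsto (fun t => (P i).h ((w t).1 i)) atTop (𝓝 ((1 / (N : ℝ)) * ∑ j, d₀ j)) := by
    intro i
    have hder := fun t (ht : 0 ≤ t) =>
      hlyap t w hw0 (hsub t) t ⟨ht, le_rfl⟩ (Ici 0) (hw t ht)
    choose! D hD hD' using hder
    have hhd : Differentiable ℝ (P i).h := (P i).h_smooth.differentiable (by simp)
    have hx : ∀ t, 0 ≤ t → HasDerivWithinAt (fun s => (w s).1 i)
        ((loopField G P U freq L γ d t (w t)).1 i) (Ici 0) t := fun t ht =>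
      hasDerivWithinAt_pi.1
        ((hasFDerivAt_fst (𝕜 := ℝ) (p := w t)).comp_hasDerivWithinAt t (hw t ht)) i
    -- The observations do not enter the agent components of the field, so `y'` is a continuous
    -- function of the state alone, bounded on the ball containing the solution.
    have hycont : Continuous fun s : LoopState n k => fderiv ℝ (P i).h (s.1 i)
        ((loopField G P U freq L γ (fun _ _ => 0) 0 s).1 i) :=
      (((P i).h_smooth.continuous_fderiv (by simp)).comp
        ((continuous_apply i).comp continuous_fst)).clm_apply
        ((continuous_apply i).comp (continuous_fst.comp hF₀.continuous))
    obtain ⟨Q, hQ⟩ := (isCompact_closedBall (0 : LoopState n k)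
      (max R (K + β))).exists_bound_of_continuousOn hycont.continuousOn
    have hzero : Tendsto (fun t => (P i).h ((w t).1 i) - ys i) atTop (𝓝 0) := by
      refine tendsto_zero_of_deriv_le_neg_sq (c := 1) (K := Q) one_pos
        (fun t ht => ((hhd _).hasFDerivAt.comp_hasDerivWithinAt t (hx t ht)).sub_const (ys i))
        (fun t ht => hQ (w t) (by simpa using hwb t ht)) hD (fun t ht => ?_)
        (fun t ht => mul_nonneg (loopStorage_nonneg hV0 _) (Real.exp_pos _).le)
      refine (hD' t ht).trans ?_
      rw [neg_one_mul]
      exact neg_le_neg (Finset.single_le_sum (f := fun i => ((P i).h ((w t).1 i) - ys i) ^ 2)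
        (fun i _ => sq_nonneg _) (Finset.mem_univ i))
    have := hzero.add_const (ys i)
    simpa only [sub_add_cancel, zero_add, havg i] using this
  refine ⟨fun i => ⟨max R (K + β), fun t ht => ?_⟩, hlim, fun hd₀ i => ?_⟩
  · exact (norm_le_pi_norm (w t).1 i).trans ((norm_fst_le _).trans (hwb t ht))
  · simpa only [hd₀] using hlim i
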